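/- **Definitions.** An *effect algebra* $(\mathcal E,0,1,\oplus)$ is a set with elements $0\ne 1$ and a partial binary operation $\oplus$ (write $a\perp b$ if $a\oplus b$ is defined) such that: if $a\perp b$ then $b\perp a$ and $b\oplus a=a\oplus b$; if $a\perp b$ and $(a\oplus b)\perp c$ then $b\perp c$, $a\perp(b\oplus c)$ and $a\oplus(b\oplus c)=(a\oplus b)\oplus c$; for every $a$ there is a unique $a'$ with $a\perp a'$ and $a\oplus a'=1$; and $a\perp 1$ implies $a=0$. It is *convex* if it carries a multiplication $[0,1]\times\mathcal E\to\mathcal E$, $(\lambda,a)\mapsto\lambda a$, such that $\alpha(\beta a)=(\alpha\beta)a$; $\alpha a\perp\beta a$ and $(\alpha+\beta)a=\alpha a\oplus\beta a$ whenever $\alpha+\beta\le 1$; $\lambda a\perp\lambda b$ and $\lambda(a\oplus b)=\lambda a\oplus\lambda b$ whenever $a\perp b$; and $1a=a$. Put $a\le b$ if $a\oplus c=b$ for some $c$. A *morphism* $\phi:\mathcal E\to\mathcal F$ satisfies $\phi(1)=1$ and, whenever $a\perp b$, $\phi(a)\perp\phi(b)$ and $\phi(a\oplus b)=\phi(a)\oplus\phi(b)$.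 An *affine isomorphism* is a surjective morphism with $\phi(\lambda a)=\lambda\phi(a)$ for all $\lambda\in[0,1]$ such that $\phi(a)\perp\phi(b)$ implies $a\perp b$. A *state* is a morphism into $[0,1]\subseteq\mathbb R$ (where $a\oplus b=a+b$ if $a+b\le1$). For a nonzero complex Hilbert space $H$, the *Hilbertian effect algebra* $\mathcal E(H)$ is the set of operators $0\le A\le I$ on $H$ with $A\oplus B=A+B$, defined if $A+B\le I$, and the usual scalar multiplication. An effect $a$ is *sharp* if the greatest lower bound of $a$ and $a'$ is $0$; a sharp $a\neq0$ is *one-dimensional* if every $b\le a$ is of the form $b=\lambda a$, $\lambda\in[0,1]$. For every one-dimensional sharp effect $a$ choose a state $\widehat a$ with $\widehat a(a)=1$. A *context* is a finite set $\{a_1,\dots,a_n\}$ of one-dimensional sharp effects with $a_1\oplus\cdots\oplus a_n=1$. $\mathcal E$ is *finite-dimensional* if it has a context, and *spectral* if every $b\in\mathcal E$ has the form $b=\lambda_1a_1\oplus\cdots\oplus\lambda_na_n$ with $\lambda_i\in[0,1]$ for some context $\{a_1,\dots,a_n\}$. For a context $\mathcal A$, $\mathcal H(\mathcal A)$ is the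 complex Hilbert space with orthonormal basis $\{\widehat a: a\in\mathcal A\}$. The set of contexts of $\mathcal E$ is *complete* if there are unitary maps $U_{\mathcal A\mathcal B}:\mathcal H(\mathcal A)\to\mathcal H(\mathcal B)$, one for each pair of contexts, such that 1. $U_{\mathcal A\mathcal A}=I$ and $U_{\mathcal A\mathcal B}=U_{\mathcal B\mathcal A}^*$ for all contexts $\mathcal A,\mathcal B$; 2. $|\langle U_{\mathcal A\mathcal B}\widehat a,U_{\mathcal C\mathcal B}\widehat c\rangle|^2=\widehat a(c)$ for all contexts $\mathcal A,\mathcal B,\mathcal C$ and all $a\in\mathcal A$, $c\in\mathcal C$; 3. for every context $\mathcal B$ and every unit vector $\phi\in\mathcal H(\mathcal B)$ there are a context $\mathcal A$, an $a\in\mathcal A$ and a $z\in\mathbb C$ with $|z|=1$ such that $U_{\mathcal A\mathcal B}\widehat a=z\phi$. **Theorem.** Let $\mathcal E$ be a finite-dimensional convex effect algebra. Then $\mathcal E$ is affinely isomorphic to a Hilbertian effect algebra $\mathcal E(H)$, for some complex Hilbert space $H$, if and only if its set of contexts is complete and $\mathcal E$ is spectral. This holds for every choice of the states $\widehat a$,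 and also if completeness is required only for some choice of them. -/

import Mathlib

universe u v

/-- An effect algebra `(E, 0, 1, ⊕)`. The partial operation `⊕` is given by its domain `Orth`
(`a ⊥ b`, i.e. `a ⊕ b` is defined) and its value `osum a b h` on that domain. -/
class EffectAlgebra (E : Type u) extends Zero E, One E where
  Orth : E → E → Prop
  osum : ∀ a b : E, Orth a b → E
  zero_ne_one : (0 : E) ≠ 1
  osum_comm : ∀ (a b : E) (h : Orth a b), ∃ h' : Orth b a, osum b a h' = osum a b h
  osum_assoc : ∀ (a b c : E) (h : Orth a b) (h' : Orth (osum a b h) c),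
    ∃ (h₁ : Orth b c) (h₂ : Orth a (osum b c h₁)),
      osum a (osum b c h₁) h₂ = osum (osum a b h) c h'
  exists_unique_compl : ∀ a : E, ∃! a' : E, ∃ h : Orth a a', osum a a' h = 1
  eq_zero_of_orth_one : ∀ a : E, Orth a 1 → a = 0

/-- A convex effect algebra: an effect algebra with multiplication by scalars in `[0, 1]`. -/
class ConvexEffectAlgebra (E : Type u) extends EffectAlgebra E, SMul unitInterval E where
  smul_smul' : ∀ (α β : unitInterval) (a : E), α • (β • a) = (α * β) • a
  add_smul' : ∀ (α β γ : unitInterval) (a : E), (γ : ℝ) = α + β →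
    ∃ h : Orth (α • a) (β • a), γ • a = osum (α • a) (β • a) h
  smul_osum : ∀ (c : unitInterval) (a b : E) (h : Orth a b),
    ∃ h' : Orth (c • a) (c • b), c • osum a b h = osum (c • a) (c • b) h'
  one_smul' : ∀ a : E, (1 : unitInterval) • a = a

namespace EffectAlgebra

section Basic

variable {E : Type u} [EffectAlgebra E]

/-- `a ≤ b` iff `a ⊕ c = b` for some `c`. -/
def Le (a b : E) : Prop := ∃ (c : E) (h : Orth a c), osum a c h = b

/-- The orthosupplement `a'`: the unique element with `a ⊕ a' = 1`. -/
noncomputable def orthosupp (a : E) : E := (exists_unique_compl a).choose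

/-- `a` is sharp iff the greatest lower bound of `a` and `a'` is `0`. -/
def IsSharp (a : E) : Prop :=
  (Le 0 a ∧ Le 0 (orthosupp a)) ∧ ∀ b : E, Le b a → Le b (orthosupp a) → Le b 0

/-- `IsOrthoSum m s`: the orthogonal sum of the finite family `m` is defined and equals `s`. -/
inductive IsOrthoSum : Multiset E → E → Prop
  | zero : IsOrthoSum 0 0
  | cons (a : E) (m : Multiset E) (s : E) (hs : IsOrthoSum m s) (h : Orth a s) :
      IsOrthoSum (a ::ₘ m) (osum a s h)

end Basic

/-- `φ : E → F` is a morphism of effect algebras: additive and unital. -/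
structure IsMorphism {E : Type u} {F : Type v} [EffectAlgebra E] [EffectAlgebra F]
    (φ : E → F) : Prop where
  map_osum : ∀ (a b : E) (h : Orth a b), ∃ h' : Orth (φ a) (φ b),
    φ (osum a b h) = osum (φ a) (φ b) h'
  map_one : φ 1 = 1

/-- The unit interval `[0, 1] ⊆ ℝ`; `a ⊕ b = a + b`, defined when `a + b ≤ 1`. -/
instance : EffectAlgebra unitInterval where
  Orth a b := (a : ℝ) + b ≤ 1
  osum a b h := ⟨(a : ℝ) + b, add_nonneg a.2.1 b.2.1, h⟩
  zero_ne_one := _root_.zero_ne_one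
  osum_comm a b h := ⟨by simpa [add_comm] using h, by ext; simp [add_comm]⟩
  osum_assoc a b c h h' := by
    have ha := a.2.1
    simp only at h h'
    exact ⟨by linarith, by simp only; linarith, by ext; simp [add_assoc]⟩
  exists_unique_compl a := by
    refine ⟨unitInterval.symm a, ⟨by simp, by ext; simp⟩, ?_⟩
    rintro y ⟨h, hy⟩
    have := congrArg Subtype.val hy
    ext
    simp at this ⊢
    linarith
  eq_zero_of_orth_one a h := by
    have h0 := a.2.1
    have h1 : (a : ℝ) + 1 ≤ 1 := h
    exact Subtype.ext (le_antisymm (by simpa using h1) h0)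

/-- A state on `E` is a morphism `E → [0, 1]`. -/
def State (E : Type u) [EffectAlgebra E] : Type u := {ω : E → unitInterval // IsMorphism ω}

end EffectAlgebra

namespace ConvexEffectAlgebra

open EffectAlgebra

/-- `φ` is an affine isomorphism: an affine morphism that reflects `⊥` and is surjective. -/
structure IsAffineIso {E : Type u} {F : Type v} [ConvexEffectAlgebra E] [ConvexEffectAlgebra F]
    (φ : E → F) : Prop extends IsMorphism φ where
  orth_of_map : ∀ a b : E, Orth (φ a) (φ b) → Orth a b
  surjective : Function.Surjective φ
  map_smul : ∀ (c : unitInterval) (a : E), φ (c • a) = c • φ a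

/-- `E` and `F` are affinely isomorphic. -/
def AffinelyIsomorphic (E : Type u) (F : Type v) [ConvexEffectAlgebra E]
    [ConvexEffectAlgebra F] : Prop := ∃ φ : E → F, IsAffineIso φ

section Contexts

variable {E : Type u} [ConvexEffectAlgebra E]

/-- `a` is a one-dimensional sharp effect, `a ∈ S₁(E)`. -/
def IsOneDimSharp (a : E) : Prop :=
  IsSharp a ∧ a ≠ 0 ∧ ∀ b : E, Le b a → ∃ c : unitInterval, b = c • a

variable (E)

/-- A context: a finite set of one-dimensional sharp effects with orthogonal sum `1`. -/
structure Context where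
  carrier : Finset E
  isOneDimSharp : ∀ a ∈ carrier, IsOneDimSharp a
  sum_eq_one : IsOrthoSum carrier.val 1

/-- `E` is finite-dimensional iff there is a context on `E`. -/
def IsFiniteDimensional : Prop := Nonempty (Context E)

/-- `E` is spectral iff every `b` is `⊕ᵢ λᵢ aᵢ` with `λᵢ ∈ [0, 1]` for some context `{aᵢ}`. -/
def IsSpectral : Prop :=
  ∀ b : E, ∃ (A : Context E) (c : E → unitInterval),
    IsOrthoSum (A.carrier.val.map fun a => c a • a) b

/-- A choice, for every one-dimensional sharp effect `a`, of a state `â` with `â(a) = 1`. -/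
structure HatChoice where
  hat : ∀ a : E, IsOneDimSharp a → State E
  hat_self : ∀ (a : E) (ha : IsOneDimSharp a), (hat a ha).1 a = 1

variable {E}

/-- The state space `H(A)` of the context `A`: the complex Hilbert space of the formal
combinations `∑ αₐ â` (`a ∈ A`), with inner product `∑ conj αₐ * βₐ`. The states `â`, `a ∈ A`, are
linearly independent, as `â(b) = 0` for `b ∈ A`, `b ≠ a`; so a vector of the complex span
of the `â` is the same as its family of coordinates `αₐ`. -/
abbrev Context.stateSpace (A : Context E) : Type u := EuclideanSpace ℂ A.carrier

/-- The vector `â ∈ H(A)`, for `a ∈ A`. -/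
noncomputable def Context.vec (A : Context E) (a : A.carrier) : A.stateSpace :=
  open Classical in EuclideanSpace.single a 1

/-- The unitaries `U A B : H(A) → H(B)` compare the contexts of `E`. -/
structure IsComparison (κ : HatChoice E)
    (U : ∀ A B : Context E, A.stateSpace ≃ₗᵢ[ℂ] B.stateSpace) : Prop where
  refl : ∀ A : Context E, U A A = LinearIsometryEquiv.refl ℂ A.stateSpace
  /-- The inverse of a unitary is its adjoint. -/
  adjoint : ∀ A B : Context E, U A B = (U B A).symm
  transition : ∀ (A B C : Context E) (a : A.carrier) (c : C.carrier),
    ‖inner ℂ (U A B (A.vec a)) (U C B (C.vec c))‖ ^ 2 =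
      ((κ.hat a (A.isOneDimSharp a a.2)).1 c : ℝ)

/-- The set of all contexts of `E` is complete: the contexts are comparable through unitaries
`U A B` such that every unit vector of every `H(B)` is, up to a phase factor, some `U A B â`. -/
def IsComplete (κ : HatChoice E) : Prop :=
  ∃ U : ∀ A B : Context E, A.stateSpace ≃ₗᵢ[ℂ] B.stateSpace, IsComparison κ U ∧
    ∀ (B : Context E) (φ : B.stateSpace), ‖φ‖ = 1 →
      ∃ (A : Context E) (a : A.carrier) (z : ℂ), ‖z‖ = 1 ∧ U A B (A.vec a) = z • φ

end Contexts

end ConvexEffectAlgebra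

/-- The set `E(H)` of operators `A` on `H` with `0 ≤ A ≤ I` (in the Loewner order). -/
def HilbertEffect (H : Type u) [NormedAddCommGroup H] [InnerProductSpace ℂ H] : Type u :=
  {A : H →L[ℂ] H // 0 ≤ A ∧ A ≤ 1}

namespace HilbertEffect

variable {H : Type u} [NormedAddCommGroup H] [InnerProductSpace ℂ H]

theorem add_nonneg' {A B : H →L[ℂ] H} (hA : 0 ≤ A) (hB : 0 ≤ B) : 0 ≤ A + B := by
  rw [ContinuousLinearMap.nonneg_iff_isPositive] at *
  exact hA.add hB

theorem le_iff_sub_nonneg {A B : H →L[ℂ] H} : A ≤ B ↔ 0 ≤ B - A := by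
  rw [ContinuousLinearMap.nonneg_iff_isPositive, ContinuousLinearMap.le_def]

theorem smul_nonneg' {A : H →L[ℂ] H} (hA : 0 ≤ A) {c : ℝ} (hc : 0 ≤ c) : 0 ≤ (c : ℂ) • A := by
  rw [ContinuousLinearMap.nonneg_iff_isPositive] at *
  exact hA.smul_of_nonneg (RCLike.ofReal_nonneg.2 hc)

theorem zero_le_one' : (0 : H →L[ℂ] H) ≤ 1 := by
  rw [ContinuousLinearMap.nonneg_iff_isPositive]
  exact ContinuousLinearMap.isPositive_one

theorem smul_le_one' {A : H →L[ℂ] H} (hA : 0 ≤ A) (hA' : A ≤ 1) {c : ℝ} (hc : c ≤ 1) :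
    (c : ℂ) • A ≤ 1 := by
  rw [le_iff_sub_nonneg] at *
  have h := add_nonneg' hA' (smul_nonneg' hA (sub_nonneg.2 hc))
  convert h using 1
  push_cast
  module

/-- Scalar multiplication of operators by `c ∈ [0, 1]`. -/
noncomputable instance : SMul unitInterval (HilbertEffect H) where
  smul c A := ⟨((c : ℝ) : ℂ) • A.1, smul_nonneg' A.2.1 c.2.1, smul_le_one' A.2.1 A.2.2 c.2.2⟩

/-- `E(H)` as a convex effect algebra: `A ⊕ B = A + B`, defined when `A + B ≤ I`. The space `H`
is nonzero, so that `0 ≠ I`. -/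
noncomputable instance [Nontrivial H] : ConvexEffectAlgebra (HilbertEffect H) where
  zero := ⟨0, le_rfl, zero_le_one'⟩
  one := ⟨1, zero_le_one', le_rfl⟩
  Orth A B := A.1 + B.1 ≤ 1
  osum A B h := ⟨A.1 + B.1, add_nonneg' A.2.1 B.2.1, h⟩
  zero_ne_one h := zero_ne_one (α := H →L[ℂ] H) (congrArg Subtype.val h)
  osum_comm A B h := ⟨by rwa [add_comm], Subtype.ext (add_comm _ _)⟩
  osum_assoc A B C h h' := by
    have h₂ : A.1 + (B.1 + C.1) ≤ 1 := by rw [← add_assoc]; exact h'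
    have h₁ : B.1 + C.1 ≤ 1 := by
      rw [le_iff_sub_nonneg] at h₂ ⊢
      have := add_nonneg' h₂ A.2.1
      convert this using 1
      abel
    exact ⟨h₁, h₂, Subtype.ext (add_assoc _ _ _).symm⟩
  exists_unique_compl A := by
    refine ⟨⟨1 - A.1, le_iff_sub_nonneg.1 A.2.2, ?_⟩, ⟨?_, ?_⟩, ?_⟩
    · rw [le_iff_sub_nonneg, sub_sub_cancel]; exact A.2.1
    · exact le_of_eq (add_sub_cancel _ _)
    · exact Subtype.ext (add_sub_cancel _ _)
    · rintro B ⟨_, hB⟩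
      exact Subtype.ext (eq_sub_of_add_eq' (congrArg Subtype.val hB))
  eq_zero_of_orth_one A h := by
    have h' : A.1 + 1 ≤ 1 := h
    refine Subtype.ext (le_antisymm ?_ A.2.1)
    rw [le_iff_sub_nonneg] at h' ⊢
    convert h' using 1
    change 0 - A.1 = _
    abel
  smul_smul' α β A := Subtype.ext (by
    change ((α : ℝ) : ℂ) • ((β : ℝ) : ℂ) • A.1 = (((α * β : unitInterval) : ℝ) : ℂ) • A.1
    rw [smul_smul]; push_cast; rfl)
  add_smul' α β γ A hγ := by
    have key : ((γ : ℝ) : ℂ) • A.1 = ((α : ℝ) : ℂ) • A.1 + ((β : ℝ) : ℂ) • A.1 := by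
      rw [hγ, ← add_smul]; push_cast; rfl
    refine ⟨?_, Subtype.ext key⟩
    change ((α : ℝ) : ℂ) • A.1 + ((β : ℝ) : ℂ) • A.1 ≤ 1
    rw [← key]
    exact smul_le_one' A.2.1 A.2.2 γ.2.2
  smul_osum c A B h := by
    have key : ((c : ℝ) : ℂ) • (A.1 + B.1) = ((c : ℝ) : ℂ) • A.1 + ((c : ℝ) : ℂ) • B.1 :=
      smul_add _ _ _
    refine ⟨?_, Subtype.ext key⟩
    change ((c : ℝ) : ℂ) • A.1 + ((c : ℝ) : ℂ) • B.1 ≤ 1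
    rw [← key]
    exact smul_le_one' (add_nonneg' A.2.1 B.2.1) h c.2.2
  one_smul' A := Subtype.ext (by
    change (((1 : unitInterval) : ℝ) : ℂ) • A.1 = A.1
    simp)

end HilbertEffect

/-- `E` is affinely isomorphic to a Hilbertian effect algebra `E(H)`, for some complex Hilbert
space `H` (of any dimension). -/
def IsHilbertian (E : Type u) [ConvexEffectAlgebra E] : Prop :=
  ∃ (H : Type v) (_ : NormedAddCommGroup H) (_ : InnerProductSpace ℂ H) (_ : CompleteSpace H)
    (_ : Nontrivial H), ConvexEffectAlgebra.AffinelyIsomorphic E (HilbertEffect H)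

/-!
Unit vectors of `H` carry both structures: `x` gives a one-dimensional sharp effect `proj x` and
the state `vectorState x`, and these determine each other. Indeed a state `ω` with
`ω (proj x) = 1` is `vectorState x`: pinching gives
`s (1 - s) • A ≤ s • (1 - proj x) + (1 - s) ⟪A x, x⟫ • proj x` for `0 < s < 1`, and evaluating `ω`
and letting `s → 1` yields `ω A ≤ ⟪A x, x⟫`, with equality by passing to `1 - A`. So for an affine
isomorphism `E → E(H)` the states `â` are forced, every context becomes an orthonormal basis of
`H`, and the unitaries between these bases show that the contexts are complete.

Conversely, complete contexts amount to orthonormal bases of a single space `H`, one for each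
context, with `|⟪a, c⟫|² = â(c)`, that exhaust the rays of `H`. Sending `∑ λᵢ aᵢ` to the operator
with eigenvalues `λᵢ` on the basis of `{aᵢ}` is then well defined, since the quadratic form of the
image of `b` at the vector of `d` is `d̂(b)`. Orthogonality is reflected because the half sum
`b / 2 ⊕ d / 2` always exists and its spectral coefficients can be read off in `E(H)`.
-/

namespace EffectAlgebra

section Sums

variable {E : Type u} [EffectAlgebra E]

/-- `IsSum a b c`: the orthogonal sum `a ⊕ b` is defined and equals `c`. As a relation, the partial
operation can be manipulated without carrying proofs of orthogonality inside terms. -/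
def IsSum (a b c : E) : Prop := ∃ h : Orth a b, osum a b h = c

theorem IsSum.comm {a b c : E} (h : IsSum a b c) : IsSum b a c := by
  obtain ⟨h, rfl⟩ := h
  exact osum_comm a b h

theorem IsSum.assoc {a b c x y : E} (h : IsSum a b x) (h' : IsSum x c y) :
    ∃ z, IsSum b c z ∧ IsSum a z y := by
  obtain ⟨h, rfl⟩ := h
  obtain ⟨h', rfl⟩ := h'
  obtain ⟨h₁, h₂, e⟩ := osum_assoc a b c h h'
  exact ⟨_, ⟨h₁, rfl⟩, h₂, e⟩

theorem IsSum.assoc_symm {a b c y z : E} (h : IsSum b c z) (h' : IsSum a z y) :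
    ∃ x, IsSum a b x ∧ IsSum x c y := by
  obtain ⟨x, hx, hy⟩ := h.comm.assoc h'.comm
  exact ⟨x, hx.comm, hy.comm⟩

theorem IsSum.left_comm {a b c y z : E} (h : IsSum b c z) (h' : IsSum a z y) :
    ∃ x, IsSum a c x ∧ IsSum b x y := by
  obtain ⟨x, hx, hy⟩ := h.assoc_symm h'
  exact hx.comm.assoc hy

theorem IsSum.unique {a b c d : E} (h : IsSum a b c) (h' : IsSum a b d) : c = d := by
  obtain ⟨_, rfl⟩ := h
  obtain ⟨_, rfl⟩ := h'
  rfl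

theorem isSum_orthosupp (a : E) : IsSum a (orthosupp a) 1 :=
  (exists_unique_compl a).choose_spec.1

theorem IsSum.eq_orthosupp {a b : E} (h : IsSum a b 1) : b = orthosupp a :=
  (exists_unique_compl a).choose_spec.2 b h

theorem IsSum.left_cancel {a b c x : E} (h : IsSum a b x) (h' : IsSum a c x) : b = c := by
  obtain ⟨y, hy, hby⟩ := h.comm.assoc (isSum_orthosupp x)
  obtain ⟨z, hz, hcz⟩ := h'.comm.assoc (isSum_orthosupp x)
  obtain rfl := hy.unique hz
  exact hby.comm.eq_orthosupp.trans hcz.comm.eq_orthosupp.symm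

theorem isSum_zero (a : E) : IsSum a 0 a := by
  have one_zero : IsSum (1 : E) 0 1 := by
    have h := isSum_orthosupp (1 : E)
    rwa [eq_zero_of_orth_one _ h.comm.1] at h
  obtain ⟨z, hz, haz⟩ := (isSum_orthosupp a).comm.assoc one_zero
  rwa [haz.left_cancel (isSum_orthosupp a).comm] at hz

theorem isSum_self_iff {a b : E} : IsSum a b a ↔ b = 0 :=
  ⟨fun h => h.left_cancel (isSum_zero a), fun h => h ▸ isSum_zero a⟩

theorem IsSum.le {a b c : E} (h : IsSum a b c) : Le a c := ⟨b, h⟩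

theorem Le.exists_isSum {a b : E} (h : Le a b) : ∃ c, IsSum a c b := h

theorem zero_le (a : E) : Le 0 a := (isSum_zero a).comm.le

theorem Le.trans {a b c : E} (h : Le a b) (h' : Le b c) : Le a c := by
  obtain ⟨x, hx⟩ := h.exists_isSum
  obtain ⟨y, hy⟩ := h'.exists_isSum
  obtain ⟨z, -, hz⟩ := hx.assoc hy
  exact hz.le

theorem IsSum.mono {a b c x y : E} (h : IsSum a b c) (hx : Le x a) (hy : Le y b) :
    ∃ z, IsSum x y z ∧ Le z c := by
  obtain ⟨p, hp⟩ := hx.exists_isSum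
  obtain ⟨q, hq⟩ := hy.exists_isSum
  obtain ⟨r, har, hrq⟩ := hq.assoc_symm h
  obtain ⟨s, hxy, hps⟩ := hp.comm.assoc har
  exact ⟨s, hxy, hps.comm.le.trans hrq.le⟩

theorem IsOrthoSum.cons_of_isSum {a s t : E} {m : Multiset E} (h : IsOrthoSum m t)
    (h' : IsSum a t s) : IsOrthoSum (a ::ₘ m) s := by
  obtain ⟨h', rfl⟩ := h'
  exact .cons a m t h h'

theorem IsOrthoSum.exists_of_cons {a s : E} {m : Multiset E} (h : IsOrthoSum (a ::ₘ m) s) :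
    ∃ t, IsOrthoSum m t ∧ IsSum a t s := by
  generalize hM : a ::ₘ m = M at h
  induction h generalizing m with
  | zero => exact absurd hM Multiset.cons_ne_zero
  | cons b m' t ht h ih =>
    rcases Multiset.cons_eq_cons.1 hM with ⟨rfl, rfl⟩ | ⟨-, n, rfl, rfl⟩
    · exact ⟨t, ht, h, rfl⟩
    · obtain ⟨r, hr, har⟩ := ih rfl
      obtain ⟨w, hw, haw⟩ := har.left_comm ⟨h, rfl⟩
      exact ⟨w, hr.cons_of_isSum hw, haw⟩

theorem isOrthoSum_zero_iff {s : E} : IsOrthoSum 0 s ↔ s = 0 := by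
  refine ⟨fun h => ?_, fun h => h ▸ .zero⟩
  generalize hM : (0 : Multiset E) = M at h
  cases h with
  | zero => rfl
  | cons a m s hs h => exact absurd hM.symm Multiset.cons_ne_zero

theorem IsOrthoSum.unique {m : Multiset E} {s t : E} (h : IsOrthoSum m s)
    (h' : IsOrthoSum m t) : s = t := by
  induction m using Multiset.induction generalizing s t with
  | empty => rw [isOrthoSum_zero_iff.1 h, isOrthoSum_zero_iff.1 h']
  | cons a m ih =>
    obtain ⟨x, hx, hax⟩ := h.exists_of_cons
    obtain ⟨y, hy, hay⟩ := h'.exists_of_cons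
    obtain rfl := ih hx hy
    exact hax.unique hay

theorem IsOrthoSum.mono {ι : Type*} {m : Multiset ι} {f g : ι → E} {s : E}
    (h : IsOrthoSum (m.map f) s) (hgf : ∀ i ∈ m, Le (g i) (f i)) :
    ∃ t, IsOrthoSum (m.map g) t ∧ Le t s := by
  induction m using Multiset.induction generalizing s with
  | empty => exact ⟨0, .zero, zero_le s⟩
  | cons i m ih =>
    rw [Multiset.map_cons] at h ⊢
    obtain ⟨x, hx, hix⟩ := h.exists_of_cons
    obtain ⟨y, hy, hyx⟩ := ih hx fun j hj => hgf j (Multiset.mem_cons_of_mem hj)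
    obtain ⟨z, hz, hzs⟩ := hix.mono (hgf i (Multiset.mem_cons_self i m)) hyx
    exact ⟨z, hy.cons_of_isSum hz, hzs⟩

end Sums

section Morphisms

variable {E : Type u} {F : Type v} [EffectAlgebra E] [EffectAlgebra F] {φ : E → F}

theorem isMorphism_of_map_isSum (hsum : ∀ a b c, IsSum a b c → IsSum (φ a) (φ b) (φ c))
    (hone : φ 1 = 1) : IsMorphism φ where
  map_osum a b h := (hsum a b _ ⟨h, rfl⟩).imp fun _ => Eq.symm
  map_one := hone

theorem IsMorphism.map_isSum (hφ : IsMorphism φ) {a b c : E} (h : IsSum a b c) :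
    IsSum (φ a) (φ b) (φ c) := by
  obtain ⟨h, rfl⟩ := h
  exact (hφ.map_osum a b h).imp fun _ => Eq.symm

theorem IsMorphism.map_zero (hφ : IsMorphism φ) : φ 0 = 0 :=
  isSum_self_iff.1 (hφ.map_isSum (isSum_zero 0))

theorem IsMorphism.map_orthosupp (hφ : IsMorphism φ) (a : E) :
    φ (orthosupp a) = orthosupp (φ a) :=
  IsSum.eq_orthosupp (hφ.map_one ▸ hφ.map_isSum (isSum_orthosupp a))

theorem IsMorphism.map_isOrthoSum (hφ : IsMorphism φ) {m : Multiset E} {s : E}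
    (h : IsOrthoSum m s) : IsOrthoSum (m.map φ) (φ s) := by
  induction h with
  | zero => rw [hφ.map_zero]; exact .zero
  | cons a m s _ h ih =>
    rw [Multiset.map_cons]
    exact ih.cons_of_isSum (hφ.map_isSum ⟨h, rfl⟩)

theorem IsMorphism.comp {G : Type*} [EffectAlgebra G] {χ : F → G} (hχ : IsMorphism χ)
    (hφ : IsMorphism φ) : IsMorphism (χ ∘ φ) :=
  isMorphism_of_map_isSum (fun _ _ _ h => hχ.map_isSum (hφ.map_isSum h))
    ((congrArg χ hφ.map_one).trans hχ.map_one)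

theorem IsMorphism.eq_one_of_map_eq_one (hφ : IsMorphism φ)
    (orth_of_map : ∀ a b, Orth (φ a) (φ b) → Orth a b) {a : E} (ha : φ a = 1) : a = 1 := by
  have map_compl : φ (orthosupp a) = 0 := by
    have h := hφ.map_isSum (isSum_orthosupp a)
    rwa [ha, hφ.map_one, isSum_self_iff] at h
  have compl_eq : orthosupp a = 0 :=
    eq_zero_of_orth_one _ (orth_of_map _ _ (by rw [map_compl]; exact (isSum_zero (φ 1)).comm.1))
  exact (isSum_zero a).unique (compl_eq ▸ isSum_orthosupp a)

theorem IsMorphism.injective (hφ : IsMorphism φ)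
    (orth_of_map : ∀ a b, Orth (φ a) (φ b) → Orth a b) : Function.Injective φ := by
  intro a b hab
  have hb : IsSum (φ a) (φ (orthosupp b)) 1 := by
    rw [hab, ← hφ.map_one]
    exact hφ.map_isSum (isSum_orthosupp b)
  have hs : IsSum a (orthosupp b) (osum a _ (orth_of_map _ _ hb.1)) := ⟨_, rfl⟩
  rw [hφ.eq_one_of_map_eq_one orth_of_map ((hφ.map_isSum hs).unique hb)] at hs
  exact hs.comm.left_cancel (isSum_orthosupp b).comm

theorem IsMorphism.map_isSum_iff (hφ : IsMorphism φ)
    (orth_of_map : ∀ a b, Orth (φ a) (φ b) → Orth a b) {a b c : E} :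
    IsSum (φ a) (φ b) (φ c) ↔ IsSum a b c := by
  refine ⟨fun h => ?_, hφ.map_isSum⟩
  have hab : IsSum a b (osum a b (orth_of_map a b h.1)) := ⟨_, rfl⟩
  rwa [hφ.injective orth_of_map ((hφ.map_isSum hab).unique h)] at hab

theorem IsMorphism.exists_isOrthoSum_of_map (hφ : IsMorphism φ)
    (orth_of_map : ∀ a b, Orth (φ a) (φ b) → Orth a b) {m : Multiset E} {t : F}
    (h : IsOrthoSum (m.map φ) t) : ∃ s, IsOrthoSum m s ∧ φ s = t := by
  induction m using Multiset.induction generalizing t with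
  | empty => exact ⟨0, .zero, hφ.map_zero.trans (isOrthoSum_zero_iff.1 h).symm⟩
  | cons a m ih =>
    rw [Multiset.map_cons] at h
    obtain ⟨_, ht, hat⟩ := h.exists_of_cons
    obtain ⟨s, hs, rfl⟩ := ih ht
    have has : IsSum a s (osum a s (orth_of_map a s hat.1)) := ⟨_, rfl⟩
    exact ⟨_, hs.cons_of_isSum has, (hφ.map_isSum has).unique hat⟩

theorem State.add {ω : State E} {a b c : E} (h : IsSum a b c) :
    (ω.1 c : ℝ) = ω.1 a + ω.1 b := by
  obtain ⟨_, e⟩ := ω.2.map_isSum h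
  exact congrArg Subtype.val e.symm

theorem State.orthosupp (ω : State E) (a : E) : (ω.1 (orthosupp a) : ℝ) = 1 - ω.1 a := by
  have h := State.add (ω := ω) (isSum_orthosupp a)
  rw [ω.2.map_one, Set.Icc.coe_one] at h
  linarith

theorem State.mono {ω : State E} {a b : E} (h : Le a b) : (ω.1 a : ℝ) ≤ ω.1 b := by
  obtain ⟨c, hc⟩ := h.exists_isSum
  rw [State.add hc]
  linarith [(ω.1 c).2.1]

theorem State.sum {ω : State E} {m : Multiset E} {s : E} (h : IsOrthoSum m s) :
    (ω.1 s : ℝ) = (m.map fun a => (ω.1 a : ℝ)).sum := by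
  induction h with
  | zero => rw [ω.2.map_zero]; rfl
  | cons a m s _ h ih => rw [Multiset.map_cons, Multiset.sum_cons, ← ih, State.add ⟨h, rfl⟩]

/-- The pullback of a state along a morphism. -/
def State.comp (ω : State F) (hφ : IsMorphism φ) : State E := ⟨ω.1 ∘ φ, ω.2.comp hφ⟩

end Morphisms

end EffectAlgebra

theorem eq_zero_of_abs_le_of_exists_two_mul {α : Type*} {g : α → ℝ} {C : ℝ}
    (g_bound : ∀ t, |g t| ≤ C) (g_double : ∀ t, ∃ s, |g s| = 2 * |g t|) (t : α) : g t = 0 := by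
  have g_small : ∀ (n : ℕ) (t), 2 ^ n * |g t| ≤ C := by
    intro n
    induction n with
    | zero => simpa using g_bound
    | succ n ih =>
      intro t
      obtain ⟨s, hs⟩ := g_double t
      calc 2 ^ (n + 1) * |g t| = 2 ^ n * |g s| := by rw [hs]; ring
        _ ≤ C := ih s
  by_contra hne
  have hpos : 0 < |g t| := abs_pos.2 hne
  obtain ⟨n, hn⟩ := pow_unbounded_of_one_lt (C / |g t|) one_lt_two
  exact ((div_lt_iff₀ hpos).1 hn).not_ge (g_small n t)

theorem unitInterval_additive_eq_mul {f : unitInterval → ℝ} (hf : ∀ t, 0 ≤ f t)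
    (hadd : ∀ r s t : unitInterval, (t : ℝ) = r + s → f t = f r + f s) (t : unitInterval) :
    f t = t * f 1 := by
  -- The defect `g` is bounded, vanishes at `1`, and can be doubled in absolute value.
  set g : unitInterval → ℝ := fun t => f t - t * f 1
  have g_add : ∀ r s t : unitInterval, (t : ℝ) = r + s → g t = g r + g s := by
    intro r s t h
    simp only [g, hadd r s t h, h]
    ring
  have g_one : g 1 = 0 := by simp [g]
  have g_bound : ∀ t, |g t| ≤ f 1 := by
    intro t
    have h : f 1 = f t + f (unitInterval.symm t) := hadd _ _ _ (by simp)
    have h0 := hf t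
    have hsymm := hf (unitInterval.symm t)
    refine abs_sub_le_of_nonneg_of_le h0 (by linarith) (mul_nonneg t.2.1 (hf 1)) ?_
    exact mul_le_of_le_one_left (hf 1) t.2.2
  have g_double_of_le : ∀ t : unitInterval, (t : ℝ) ≤ 1 / 2 → ∃ s, |g s| = 2 * |g t| := by
    intro t ht
    refine ⟨⟨t + t, by linarith [t.2.1], by linarith⟩, ?_⟩
    rw [g_add t t _ rfl, ← two_mul, abs_mul, abs_two]
  have g_double : ∀ t, ∃ s, |g s| = 2 * |g t| := by
    intro t
    rcases le_total (t : ℝ) (1 / 2) with ht | ht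
    · exact g_double_of_le t ht
    · have hsymm : g (unitInterval.symm t) = -g t := by
        linarith [g_add t (unitInterval.symm t) 1 (by simp)]
      rw [← abs_neg, ← hsymm]
      exact g_double_of_le _ (by rw [unitInterval.coe_symm_eq]; linarith)
  exact sub_eq_zero.1 (eq_zero_of_abs_le_of_exists_two_mul g_bound g_double t)

namespace ConvexEffectAlgebra

open EffectAlgebra

section Scalars

variable {E : Type u} [ConvexEffectAlgebra E]

theorem isSum_smul_add {α β γ : unitInterval} (a : E) (h : (γ : ℝ) = α + β) :
    IsSum (α • a) (β • a) (γ • a) :=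
  (add_smul' α β γ a h).imp fun _ => Eq.symm

theorem isSum_smul_symm_smul (c : unitInterval) (a : E) :
    IsSum (c • a) (unitInterval.symm c • a) a := by
  simpa only [one_smul'] using
    isSum_smul_add (α := c) (β := unitInterval.symm c) (γ := 1) a (by simp)

theorem isSum_smul (c : unitInterval) {a b s : E} (h : IsSum a b s) :
    IsSum (c • a) (c • b) (c • s) := by
  obtain ⟨h, rfl⟩ := h
  exact (smul_osum c a b h).imp fun _ => Eq.symm

theorem smul_zero' (c : unitInterval) : c • (0 : E) = 0 :=
  isSum_self_iff.1 (isSum_smul c (isSum_zero 0))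

theorem zero_smul' (a : E) : (0 : unitInterval) • a = 0 :=
  isSum_self_iff.1 (isSum_smul_add (α := 0) (γ := 0) a (by simp))

theorem smul_le (c : unitInterval) (a : E) : Le (c • a) a :=
  (isSum_smul_symm_smul c a).le

theorem smul_le_smul (c : unitInterval) {a b : E} (h : Le a b) : Le (c • a) (c • b) := by
  obtain ⟨d, hd⟩ := h.exists_isSum
  exact (isSum_smul c hd).le

theorem isOrthoSum_smul {m : Multiset E} {s : E} (h : IsOrthoSum m s) (c : unitInterval) :
    IsOrthoSum (m.map (c • ·)) (c • s) := by
  induction h with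
  | zero => rw [smul_zero']; exact .zero
  | cons a m s _ h ih =>
    rw [Multiset.map_cons]
    exact ih.cons_of_isSum (isSum_smul c ⟨h, rfl⟩)

theorem exists_isSum_convex (c : unitInterval) (a b : E) :
    ∃ d, IsSum (c • a) (unitInterval.symm c • b) d := by
  obtain ⟨d, hd, -⟩ := (isSum_smul_symm_smul c (1 : E)).mono
    (smul_le_smul c (isSum_orthosupp a).le)
    (smul_le_smul (unitInterval.symm c) (isSum_orthosupp b).le)
  exact ⟨d, hd⟩

/-- The scalar `1 / 2` of the unit interval. -/
noncomputable def half : unitInterval := ⟨1 / 2, by norm_num, by norm_num⟩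

theorem coe_half : (half : ℝ) = 1 / 2 := rfl

theorem symm_half : unitInterval.symm half = half :=
  Subtype.ext (by rw [unitInterval.coe_symm_eq, coe_half]; norm_num)

theorem isSum_half (a : E) : IsSum (half • a) (half • a) a := by
  simpa only [symm_half] using isSum_smul_symm_smul half a

theorem isSum_of_half {a b c : E} (h : IsSum (half • a) (half • b) (half • c)) :
    IsSum a b c := by
  obtain ⟨x, hx, hax⟩ := h.assoc (isSum_half c)
  obtain ⟨y, hy, hby⟩ := h.left_comm hx
  obtain ⟨z, hz, hzy⟩ := hby.assoc_symm hax
  rwa [← (isSum_half a).unique hz, ← (isSum_half b).unique hy] at hzy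

theorem state_smul (ω : State E) (c : unitInterval) (a : E) :
    (ω.1 (c • a) : ℝ) = c * ω.1 a := by
  have h := unitInterval_additive_eq_mul (f := fun t => (ω.1 (t • a) : ℝ))
    (fun t => (ω.1 (t • a)).2.1) (fun _ _ _ h => State.add (isSum_smul_add a h)) c
  simpa only [one_smul'] using h

end Scalars

section AffineIso

variable {E : Type u} {F : Type v} [ConvexEffectAlgebra E] [ConvexEffectAlgebra F] {φ : E → F}

theorem IsAffineIso.injective (hφ : IsAffineIso φ) : Function.Injective φ :=
  hφ.toIsMorphism.injective hφ.orth_of_map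

theorem IsAffineIso.map_isSum_iff (hφ : IsAffineIso φ) {a b c : E} :
    IsSum (φ a) (φ b) (φ c) ↔ IsSum a b c :=
  hφ.toIsMorphism.map_isSum_iff hφ.orth_of_map

theorem IsAffineIso.map_le_iff (hφ : IsAffineIso φ) {a b : E} : Le (φ a) (φ b) ↔ Le a b := by
  constructor <;> intro h <;> obtain ⟨c, hc⟩ := h.exists_isSum
  · obtain ⟨c, rfl⟩ := hφ.surjective c
    exact (hφ.map_isSum_iff.1 hc).le
  · exact (hφ.toIsMorphism.map_isSum hc).le

theorem IsAffineIso.exists_inverse (hφ : IsAffineIso φ) :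
    ∃ χ : F → E, IsAffineIso χ ∧ Function.LeftInverse χ φ ∧ Function.RightInverse χ φ := by
  obtain ⟨χ, hl, hr⟩ := Function.bijective_iff_has_inverse.1 ⟨hφ.injective, hφ.surjective⟩
  refine ⟨χ, ⟨isMorphism_of_map_isSum ?_ ?_, ?_, hl.surjective, ?_⟩, hl, hr⟩
  · intro a b c h
    rwa [← hφ.map_isSum_iff, hr a, hr b, hr c]
  · rw [← hφ.map_one, hl]
  · intro a b h
    have := (hφ.map_osum _ _ h).1
    rwa [hr a, hr b] at this
  · intro c a
    rw [← hl (c • χ a), hφ.map_smul, hr a]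

theorem IsOneDimSharp.map {a : E} (ha : IsOneDimSharp a) (hφ : IsAffineIso φ) :
    IsOneDimSharp (φ a) := by
  obtain ⟨⟨-, meet_eq_zero⟩, ha0, ha1⟩ := ha
  refine ⟨⟨⟨zero_le _, zero_le _⟩, fun b hb hb' => ?_⟩, fun h => ?_, fun b hb => ?_⟩
  · obtain ⟨b, rfl⟩ := hφ.surjective b
    rw [← hφ.map_orthosupp, hφ.map_le_iff] at hb'
    rw [← hφ.map_zero, hφ.map_le_iff]
    exact meet_eq_zero b (hφ.map_le_iff.1 hb) hb'
  · exact ha0 (hφ.injective (h.trans hφ.map_zero.symm))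
  · obtain ⟨b, rfl⟩ := hφ.surjective b
    exact (ha1 b (hφ.map_le_iff.1 hb)).imp fun c hc => by rw [hc, hφ.map_smul]

/-- The image of a context under an affine isomorphism. -/
def Context.map (A : Context E) (hφ : IsAffineIso φ) : Context F where
  carrier := A.carrier.map ⟨φ, hφ.injective⟩
  isOneDimSharp := Finset.forall_mem_map.2 fun a ha => (A.isOneDimSharp a ha).map hφ
  sum_eq_one := hφ.map_one ▸ hφ.toIsMorphism.map_isOrthoSum A.sum_eq_one

theorem IsSpectral.map (hE : IsSpectral E) (hφ : IsAffineIso φ) : IsSpectral F := by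
  intro b
  obtain ⟨b, rfl⟩ := hφ.surjective b
  obtain ⟨χ, -, hχ, -⟩ := hφ.exists_inverse
  obtain ⟨A, c, hb⟩ := hE b
  refine ⟨A.map hφ, c ∘ χ, ?_⟩
  have h := hφ.toIsMorphism.map_isOrthoSum hb
  rw [Multiset.map_map] at h
  convert h using 1
  refine (Multiset.map_map _ _ _).trans (Multiset.map_congr rfl fun a _ => ?_)
  simp [hχ a, hφ.map_smul]

end AffineIso

end ConvexEffectAlgebra

open InnerProductSpace

section StarOrderedRing

variable {R : Type*} [Ring R] [StarRing R] [PartialOrder R] [StarOrderedRing R] {t : R}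

theorem mul_one_sub_self_nonneg (h0 : 0 ≤ t) (h1 : t ≤ 1) : 0 ≤ t * (1 - t) := by
  have h1' := sub_nonneg.2 h1
  calc 0 ≤ t * (1 - t) * t + (1 - t) * t * (1 - t) :=
        add_nonneg (conjugate_nonneg_of_nonneg h1' h0) (conjugate_nonneg_of_nonneg h0 h1')
    _ = t * (1 - t) := by noncomm_ring

theorem mul_one_sub_self_le (h : IsSelfAdjoint t) : t * (1 - t) ≤ t := by
  have hsq : t - t * (1 - t) = t * t := by noncomm_ring
  exact sub_nonneg.1 (hsq ▸ h.mul_self_nonneg)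

theorem mul_one_sub_self_le_one_sub (h : IsSelfAdjoint t) : t * (1 - t) ≤ 1 - t := by
  have hsq : 1 - t - t * (1 - t) = (1 - t) * (1 - t) := by noncomm_ring
  exact sub_nonneg.1 (hsq ▸ ((IsSelfAdjoint.one R).sub h).mul_self_nonneg)

theorem smul_le_smul_conjugate_add_smul_conjugate [Algebra ℝ R] [StarModule ℝ R] {p : R}
    (hp : IsSelfAdjoint p) (ht : 0 ≤ t) (s : ℝ) :
    (s * (1 - s)) • t ≤ (1 - s) • (p * t * p) + s • ((1 - p) * t * (1 - p)) := by
  have hps : IsSelfAdjoint (p - s • 1) :=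
    hp.sub ((IsSelfAdjoint.all s).smul (IsSelfAdjoint.one R))
  refine sub_nonneg.1 ((IsSelfAdjoint.conjugate_nonneg ht hps).trans_eq ?_)
  simp only [mul_sub, sub_mul, mul_one, one_mul, smul_mul_assoc, mul_smul_comm]
  module

end StarOrderedRing

theorem exists_orthonormalBasis_of_sum_sq_norm_inner {𝕜 ι H : Type*} [RCLike 𝕜] [Fintype ι]
    [NormedAddCommGroup H] [InnerProductSpace 𝕜 H] {x : ι → H} (hx : ∀ i, ‖x i‖ = 1)
    (hsum : ∀ y : H, ‖y‖ = 1 → ∑ i, ‖inner 𝕜 (x i) y‖ ^ 2 = 1) :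
    ∃ e : OrthonormalBasis ι 𝕜 H, ⇑e = x := by
  classical
  have orthonormal : Orthonormal 𝕜 x := by
    refine ⟨hx, fun i j hij => ?_⟩
    have h := hsum (x j) (hx j)
    rw [← Finset.add_sum_erase _ _ (Finset.mem_univ j), inner_self_eq_norm_sq_to_K, hx,
      RCLike.ofReal_one, one_pow, norm_one, one_pow, add_eq_left,
      Finset.sum_eq_zero_iff_of_nonneg fun _ _ => by positivity] at h
    simpa using h i (Finset.mem_erase.2 ⟨hij, Finset.mem_univ i⟩)
  refine ⟨.mkOfOrthogonalEqBot orthonormal ?_, OrthonormalBasis.coe_of_orthogonal_eq_bot_mk _ _⟩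
  refine (Submodule.eq_bot_iff _).2 fun y hy => ?_
  by_contra hy0
  have hperp : ∀ i, inner 𝕜 (x i) ((‖y‖⁻¹ : 𝕜) • y) = 0 := fun i => by
    rw [inner_smul_right, (Submodule.mem_orthogonal _ y).1 hy _ (Submodule.subset_span ⟨i, rfl⟩),
      mul_zero]
  have h := hsum ((‖y‖⁻¹ : 𝕜) • y) (norm_smul_inv_norm hy0)
  simp [hperp] at h

section Operators

variable {H : Type*} [NormedAddCommGroup H] [InnerProductSpace ℂ H]

theorem nonneg_iff_reApplyInnerSelf_nonneg {T : H →L[ℂ] H} (hT : T.IsSymmetric) :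
    0 ≤ T ↔ ∀ x, ‖x‖ = 1 → 0 ≤ T.reApplyInnerSelf x := by
  rw [ContinuousLinearMap.nonneg_iff_isPositive, ContinuousLinearMap.isPositive_def]
  refine ⟨fun h x _ => h.2 x, fun h => ⟨hT, fun x => ?_⟩⟩
  rcases eq_or_ne x 0 with rfl | hx
  · simp [ContinuousLinearMap.reApplyInnerSelf_apply]
  · have hunit := h ((‖x‖⁻¹ : ℂ) • x) (norm_smul_inv_norm hx)
    rw [ContinuousLinearMap.reApplyInnerSelf_smul] at hunit
    exact (mul_nonneg_iff_of_pos_left (by simp [hx])).1 hunit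

theorem le_iff_reApplyInnerSelf_le {S T : H →L[ℂ] H} (hS : S.IsSymmetric) (hT : T.IsSymmetric) :
    S ≤ T ↔ ∀ x, ‖x‖ = 1 → S.reApplyInnerSelf x ≤ T.reApplyInnerSelf x := by
  rw [HilbertEffect.le_iff_sub_nonneg, nonneg_iff_reApplyInnerSelf_nonneg (hT.sub hS)]
  simp [ContinuousLinearMap.reApplyInnerSelf_apply, inner_sub_left]

theorem rankOne_mul_mul_rankOne [CompleteSpace H] {T : H →L[ℂ] H} (hT : T.IsSymmetric) (x : H) :
    rankOne ℂ x x * T * rankOne ℂ x x = T.reApplyInnerSelf x • rankOne ℂ x x := by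
  rw [mul_assoc, ContinuousLinearMap.mul_def, ContinuousLinearMap.mul_def, comp_rankOne,
    rankOne_comp_rankOne, ← Complex.coe_smul]
  exact congrArg (· • rankOne ℂ x x) ((hT x x).symm.trans (hT.coe_reApplyInnerSelf_apply x).symm)

end Operators

namespace HilbertEffect

open EffectAlgebra ConvexEffectAlgebra

variable {H : Type u} [NormedAddCommGroup H] [InnerProductSpace ℂ H]

theorem isSymmetric (A : HilbertEffect H) : A.1.IsSymmetric :=
  ((ContinuousLinearMap.nonneg_iff_isPositive _).1 A.2.1).isSymmetric

theorem coe_smul (c : unitInterval) (A : HilbertEffect H) : (c • A).1 = (c : ℝ) • A.1 :=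
  Complex.coe_smul (c : ℝ) A.1

theorem reApplyInnerSelf_mem_Icc {x : H} (hx : ‖x‖ = 1) (A : HilbertEffect H) :
    A.1.reApplyInnerSelf x ∈ Set.Icc 0 1 := by
  refine ⟨((ContinuousLinearMap.nonneg_iff_isPositive _).1 A.2.1).2 x, ?_⟩
  have h := ((ContinuousLinearMap.le_def _ _).1 A.2.2).2 x
  simpa [ContinuousLinearMap.reApplyInnerSelf_apply, inner_sub_left, hx] using h

section EffectAlgebra

variable [Nontrivial H] {A B C : HilbertEffect H}

theorem coe_one : (1 : HilbertEffect H).1 = 1 := rfl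

theorem isSum_iff : IsSum A B C ↔ A.1 + B.1 = C.1 :=
  ⟨fun ⟨_, h⟩ => congrArg Subtype.val h, fun h => ⟨h.trans_le C.2.2, Subtype.ext h⟩⟩

theorem coe_orthosupp (A : HilbertEffect H) : (orthosupp A).1 = 1 - A.1 :=
  eq_sub_of_add_eq' (isSum_iff.1 (isSum_orthosupp A))

variable [CompleteSpace H]

theorem le_iff : Le A B ↔ A.1 ≤ B.1 := by
  refine ⟨fun h => ?_, fun h => ?_⟩
  · obtain ⟨C, hC⟩ := h.exists_isSum
    exact (le_add_of_nonneg_right C.2.1).trans_eq (isSum_iff.1 hC)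
  · have sub_le_one : B.1 - A.1 ≤ 1 := (sub_le_self _ A.2.1).trans B.2.2
    exact IsSum.le (b := ⟨B.1 - A.1, sub_nonneg.2 h, sub_le_one⟩) (isSum_iff.2 (add_sub_cancel _ _))

theorem isOrthoSum_iff {m : Multiset (HilbertEffect H)} {S : HilbertEffect H} :
    IsOrthoSum m S ↔ (m.map fun B => B.1).sum = S.1 := by
  refine ⟨fun h => ?_, fun h => ?_⟩
  · induction h with
    | zero => rfl
    | cons A m S _ h ih =>
      rw [Multiset.map_cons, Multiset.sum_cons, ih]
      rfl
  · induction m using Multiset.induction generalizing S with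
    | empty => exact isOrthoSum_zero_iff.2 (Subtype.ext h.symm)
    | cons A m ih =>
      rw [Multiset.map_cons, Multiset.sum_cons] at h
      have tail_nonneg : 0 ≤ (m.map fun B => B.1).sum :=
        Multiset.sum_nonneg (Multiset.forall_mem_map_iff.2 fun B _ => B.2.1)
      have tail_le : (m.map fun B => B.1).sum ≤ 1 :=
        ((le_add_of_nonneg_left A.2.1).trans_eq h).trans S.2.2
      exact (ih (S := ⟨_, tail_nonneg, tail_le⟩) rfl).cons_of_isSum (isSum_iff.2 h)

end EffectAlgebra

section VectorState

variable [Nontrivial H]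

/-- The vector state `A ↦ ⟪A x, x⟫` of a unit vector `x`. -/
noncomputable def vectorState (x : H) (hx : ‖x‖ = 1) : State (HilbertEffect H) where
  val A := ⟨A.1.reApplyInnerSelf x, reApplyInnerSelf_mem_Icc hx A⟩
  property := by
    refine isMorphism_of_map_isSum (fun A B C h => ?_) (Subtype.ext ?_)
    · have hsum : A.1.reApplyInnerSelf x + B.1.reApplyInnerSelf x = C.1.reApplyInnerSelf x := by
        simp [← isSum_iff.1 h, ContinuousLinearMap.reApplyInnerSelf_apply, inner_add_left]
      exact ⟨hsum.trans_le (reApplyInnerSelf_mem_Icc hx C).2, Subtype.ext hsum⟩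
    · simp [coe_one, ContinuousLinearMap.reApplyInnerSelf_apply, hx]

variable {x y : H} {hx : ‖x‖ = 1} {hy : ‖y‖ = 1} {A B C : HilbertEffect H}

theorem coe_vectorState : ((vectorState x hx).1 A : ℝ) = A.1.reApplyInnerSelf x := rfl

theorem vectorState_smul {z : ℂ} (hz : ‖z‖ = 1) (hzx : ‖z • x‖ = 1) :
    vectorState (z • x) hzx = vectorState x hx := by
  refine Subtype.ext (funext fun A => Subtype.ext ?_)
  rw [coe_vectorState, ContinuousLinearMap.reApplyInnerSelf_smul, hz, one_pow, one_mul,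
    coe_vectorState]

theorem le_iff_forall_vectorState [CompleteSpace H] :
    Le A B ↔ ∀ x (hx : ‖x‖ = 1), (vectorState x hx).1 A ≤ (vectorState x hx).1 B :=
  le_iff.trans (le_iff_reApplyInnerSelf_le A.isSymmetric B.isSymmetric)

theorem ext_of_vectorState [CompleteSpace H]
    (h : ∀ x (hx : ‖x‖ = 1), (vectorState x hx).1 A = (vectorState x hx).1 B) : A = B :=
  Subtype.ext (le_antisymm (le_iff.1 (le_iff_forall_vectorState.2 fun x hx => (h x hx).le))
    (le_iff.1 (le_iff_forall_vectorState.2 fun x hx => (h x hx).ge)))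

theorem isSum_iff_forall_vectorState [CompleteSpace H] :
    IsSum A B C ↔ ∀ x (hx : ‖x‖ = 1),
      ((vectorState x hx).1 C : ℝ) = (vectorState x hx).1 A + (vectorState x hx).1 B := by
  refine ⟨fun h x hx => State.add h, fun h => ?_⟩
  have hAC : Le A C := le_iff_forall_vectorState.2 fun x hx =>
    Subtype.coe_le_coe.1 (by linarith [h x hx, ((vectorState x hx).1 B).2.1])
  obtain ⟨D, hD⟩ := hAC.exists_isSum
  rwa [ext_of_vectorState (A := B) (B := D) fun x hx =>
    Subtype.ext (by linarith [h x hx, State.add (ω := vectorState x hx) hD])]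

end VectorState

section Proj

variable [CompleteSpace H]

/-- The orthogonal projection onto the line spanned by the unit vector `x`. -/
noncomputable def proj (x : H) (hx : ‖x‖ = 1) : HilbertEffect H :=
  ⟨rankOne ℂ x x, (isStarProjection_rankOne_self hx).nonneg,
    (isStarProjection_rankOne_self hx).le_one⟩

variable {x y : H} {hx : ‖x‖ = 1} {hy : ‖y‖ = 1}

theorem coe_proj : (proj x hx).1 = rankOne ℂ x x := rfl

theorem isStarProjection_proj : IsStarProjection (proj x hx).1 :=
  isStarProjection_rankOne_self hx

theorem proj_smul {z : ℂ} (hz : ‖z‖ = 1) (hzx : ‖z • x‖ = 1) : proj (z • x) hzx = proj x hx := by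
  refine Subtype.ext (ContinuousLinearMap.ext fun v => ?_)
  rw [coe_proj, coe_proj, rankOne_apply, rankOne_apply, inner_smul_left, smul_smul,
    mul_right_comm, Complex.conj_mul', hz]
  simp

theorem exists_eq_smul_of_proj_eq (h : proj x hx = proj y hy) : ∃ z : ℂ, ‖z‖ = 1 ∧ x = z • y := by
  have hx0 : x ≠ 0 := norm_ne_zero_iff.1 (hx.trans_ne one_ne_zero)
  obtain ⟨z, -, -, -, rfl, -⟩ := exists_of_rankOne_eq_rankOne hx0 hx0 (congrArg Subtype.val h)
  exact ⟨z, by rwa [norm_smul, hy, mul_one] at hx, rfl⟩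

variable [Nontrivial H] {A B : HilbertEffect H}

theorem vectorState_proj : ((vectorState y hy).1 (proj x hx) : ℝ) = ‖⟪x, y⟫_ℂ‖ ^ 2 := by
  rw [coe_vectorState, coe_proj, ContinuousLinearMap.reApplyInnerSelf_apply, rankOne_apply,
    inner_smul_left, Complex.conj_mul']
  simp [← Complex.ofReal_pow]

theorem vectorState_proj_self : (vectorState x hx).1 (proj x hx) = 1 :=
  Subtype.ext (by simp [vectorState_proj, hx])

theorem eq_smul_proj_of_le (h : Le A (proj x hx)) : A = (vectorState x hx).1 A • proj x hx := by
  refine Subtype.ext ?_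
  rw [coe_smul, coe_vectorState, coe_proj, ← rankOne_mul_mul_rankOne A.isSymmetric]
  exact (isStarProjection_proj.conjugate_of_nonneg_of_le A.2.1 (le_iff.1 h)).symm

theorem isOneDimSharp_proj : IsOneDimSharp (proj x hx) := by
  refine ⟨⟨⟨zero_le _, zero_le _⟩, fun A hA hA' => ?_⟩, fun h => ?_, fun A hA =>
    ⟨_, eq_smul_proj_of_le hA⟩⟩
  · have vectorState_eq_zero : (vectorState x hx).1 A = 0 := by
      have h := State.mono (ω := vectorState x hx) hA'
      rw [State.orthosupp, vectorState_proj_self, Set.Icc.coe_one, sub_self] at h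
      exact Subtype.ext (le_antisymm h ((vectorState x hx).1 A).2.1)
    rw [eq_smul_proj_of_le hA, vectorState_eq_zero, zero_smul']
    exact zero_le 0
  · have self_eq_one := vectorState_proj_self (hx := hx)
    rw [h, (vectorState x hx).2.map_zero] at self_eq_one
    exact _root_.zero_ne_one self_eq_one

theorem isStarProjection_of_isSharp (hA : IsSharp A) : IsStarProjection A.1 := by
  have hsa : IsSelfAdjoint A.1 := .of_nonneg A.2.1
  let B : HilbertEffect H := ⟨A.1 * (1 - A.1), mul_one_sub_self_nonneg A.2.1 A.2.2,
    (mul_one_sub_self_le hsa).trans A.2.2⟩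
  have hB : Le B 0 := hA.2 B (le_iff.2 (mul_one_sub_self_le hsa))
    (le_iff.2 ((mul_one_sub_self_le_one_sub hsa).trans_eq (coe_orthosupp A).symm))
  have mul_eq_zero : A.1 * (1 - A.1) = 0 := le_antisymm (le_iff.1 hB) B.2.1
  rw [mul_sub, mul_one, sub_eq_zero] at mul_eq_zero
  exact ⟨mul_eq_zero.symm, hsa⟩

theorem exists_eq_proj_of_isOneDimSharp (hA : IsOneDimSharp A) : ∃ x hx, A = proj x hx := by
  obtain ⟨hsharp, hA0, hA1⟩ := hA
  have hproj := isStarProjection_of_isSharp hsharp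
  obtain ⟨y, hy⟩ : ∃ y, A.1 y ≠ 0 := by
    by_contra! h
    exact hA0 (Subtype.ext (ContinuousLinearMap.ext h))
  set x : H := (‖A.1 y‖⁻¹ : ℂ) • A.1 y
  have hx : ‖x‖ = 1 := norm_smul_inv_norm hy
  have map_x : A.1 x = x := by
    rw [map_smul]
    exact congrArg _ (DFunLike.congr_fun hproj.isIdempotentElem.eq y)
  have proj_le : (proj x hx).1 ≤ A.1 := by
    refine isStarProjection_proj.le_of_mul_eq_right hproj ?_
    rw [coe_proj, ContinuousLinearMap.mul_def, comp_rankOne, map_x]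
  obtain ⟨c, hc⟩ := hA1 _ (le_iff.2 proj_le)
  have c_eq_one : c = 1 := by
    have h := state_smul (vectorState x hx) c A
    rw [← hc, vectorState_proj_self, coe_vectorState, ContinuousLinearMap.reApplyInnerSelf_apply,
      map_x] at h
    exact Subtype.ext (by simpa [hx] using h.symm)
  exact ⟨x, hx, by rw [hc, c_eq_one, one_smul']⟩

theorem smul_le_of_isSum_proj {s : unitInterval}
    (h : IsSum (s • orthosupp (proj x hx))
      (unitInterval.symm s • (vectorState x hx).1 A • proj x hx) B) :
    Le ((s * unitInterval.symm s) • A) B := by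
  set p := (proj x hx).1 with hp
  have hpsa : IsSelfAdjoint p := isStarProjection_proj.isSelfAdjoint
  have conj_eq : p * A.1 * p = A.1.reApplyInnerSelf x • p := rankOne_mul_mul_rankOne A.isSymmetric x
  have conj_compl_le : (1 - p) * A.1 * (1 - p) ≤ 1 - p := by
    refine (((IsSelfAdjoint.one _).sub hpsa).conjugate_le_conjugate A.2.2).trans_eq ?_
    rw [mul_one]
    exact isStarProjection_proj.one_sub.isIdempotentElem.eq
  rw [le_iff, ← isSum_iff.1 h]
  simp only [coe_smul, coe_orthosupp, coe_vectorState, ← hp, Set.Icc.coe_mul,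
    unitInterval.coe_symm_eq]
  calc ((s : ℝ) * (1 - s)) • A.1
      ≤ (1 - s : ℝ) • (p * A.1 * p) + (s : ℝ) • ((1 - p) * A.1 * (1 - p)) :=
        smul_le_smul_conjugate_add_smul_conjugate hpsa A.2.1 s
    _ ≤ (1 - s : ℝ) • (p * A.1 * p) + (s : ℝ) • (1 - p) := by
        gcongr
        exact s.2.1
    _ = (s : ℝ) • (1 - p) + (1 - s : ℝ) • A.1.reApplyInnerSelf x • p := by
        rw [conj_eq, add_comm]

theorem state_le_vectorState {ω : State (HilbertEffect H)} (hω : ω.1 (proj x hx) = 1)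
    (A : HilbertEffect H) : ω.1 A ≤ (vectorState x hx).1 A := by
  have hω' : (ω.1 (orthosupp (proj x hx)) : ℝ) = 0 := by simp [State.orthosupp, hω]
  -- Pinching by `s` and dividing by `1 - s`; the bound is sharp only in the limit `s → 1`.
  have mul_le : ∀ s ∈ Set.Ioo (0 : ℝ) 1, s * ω.1 A ≤ (vectorState x hx).1 A := by
    intro s hs
    obtain ⟨D, hD⟩ := exists_isSum_convex ⟨s, hs.1.le, hs.2.le⟩ (orthosupp (proj x hx))
      ((vectorState x hx).1 A • proj x hx)
    have h := State.mono (ω := ω) (smul_le_of_isSum_proj hD)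
    rw [State.add hD, state_smul, state_smul, state_smul, state_smul, hω', hω] at h
    simp only [Set.Icc.coe_mul, unitInterval.coe_symm_eq, Set.Icc.coe_one] at h
    have hs' : 0 < 1 - s := sub_pos.2 hs.2
    nlinarith
  refine Subtype.coe_le_coe.1 (le_of_tendsto (f := fun s : ℝ => s * ω.1 A) ?_
    (Filter.eventually_of_mem (Ioo_mem_nhdsLT one_pos) mul_le))
  exact ((continuous_mul_const _).tendsto' _ _ (one_mul _)).mono_left nhdsWithin_le_nhds

theorem state_eq_vectorState {ω : State (HilbertEffect H)} (hω : ω.1 (proj x hx) = 1) :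
    ω = vectorState x hx := by
  refine Subtype.ext (funext fun A => le_antisymm (state_le_vectorState hω A) ?_)
  have h := Subtype.coe_le_coe.2 (state_le_vectorState hω (orthosupp A))
  rw [State.orthosupp, State.orthosupp] at h
  exact Subtype.coe_le_coe.1 (by linarith)

end Proj

section Bases

variable [CompleteSpace H] {ι : Type*} [Fintype ι] (e : OrthonormalBasis ι ℂ H)

theorem proj_injective : Function.Injective fun i => proj (e i) (e.norm_eq_one i) := by
  intro i j hij
  obtain ⟨z, hnorm, hz⟩ := exists_eq_smul_of_proj_eq hij
  by_contra hne
  have hz0 := e.inner_eq_zero (Ne.symm hne)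
  rw [hz, inner_smul_right, e.inner_eq_one, mul_one] at hz0
  simp [hz0] at hnorm

variable [Nontrivial H]

theorem isOrthoSum_proj :
    IsOrthoSum (Finset.univ.val.map fun i => proj (e i) (e.norm_eq_one i)) 1 := by
  rw [isOrthoSum_iff, Multiset.map_map]
  exact e.sum_rankOne_eq_id

/-- The context of the projections onto the lines of an orthonormal basis. -/
noncomputable def context : Context (HilbertEffect H) where
  carrier := Finset.univ.map ⟨_, proj_injective e⟩
  isOneDimSharp := Finset.forall_mem_map.2 fun i _ =>
    isOneDimSharp_proj (hx := e.norm_eq_one i)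
  sum_eq_one := isOrthoSum_proj e

theorem isOrthoSum_smul_proj_of_eigenvectors {c : ι → unitInterval} {A : HilbertEffect H}
    (h : ∀ i, A.1 (e i) = (c i : ℝ) • e i) :
    IsOrthoSum (Finset.univ.val.map fun i => c i • proj (e i) (e.norm_eq_one i)) A := by
  rw [isOrthoSum_iff, Multiset.map_map]
  calc ∑ i, (c i • proj (e i) (e.norm_eq_one i)).1
      = ∑ i, A.1 * rankOne ℂ (e i) (e i) := Finset.sum_congr rfl fun i _ => by
        rw [coe_smul, coe_proj, ContinuousLinearMap.mul_def, comp_rankOne, h]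
        ext
        simp
    _ = A.1 * .id ℂ H := by rw [← Finset.mul_sum, e.sum_rankOne_eq_id]
    _ = A.1 := mul_one A.1

end Bases

theorem exists_isOrthoSum_smul_proj [FiniteDimensional ℂ H] [CompleteSpace H] [Nontrivial H]
    (A : HilbertEffect H) :
    ∃ (e : OrthonormalBasis (Fin (Module.finrank ℂ H)) ℂ H) (c : Fin _ → unitInterval),
      IsOrthoSum (Finset.univ.val.map fun i => c i • proj (e i) (e.norm_eq_one i)) A := by
  let e := A.isSymmetric.eigenvectorBasis rfl
  refine ⟨e, fun i => (vectorState (e i) (e.norm_eq_one i)).1 A,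
    isOrthoSum_smul_proj_of_eigenvectors e fun i => ?_⟩
  have eigen : A.1 (e i) = (A.isSymmetric.eigenvalues rfl i : ℂ) • e i :=
    A.isSymmetric.apply_eigenvectorBasis rfl i
  rw [coe_vectorState, ContinuousLinearMap.reApplyInnerSelf_apply, eigen, inner_smul_left,
    e.inner_eq_one, ← Complex.coe_smul]
  simp

theorem isSpectral [FiniteDimensional ℂ H] [Nontrivial H] : IsSpectral (HilbertEffect H) := by
  have := FiniteDimensional.complete ℂ H
  intro A
  obtain ⟨e, c, h⟩ := exists_isOrthoSum_smul_proj A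
  refine ⟨context e, Function.extend (fun i => proj (e i) (e.norm_eq_one i)) c 0, ?_⟩
  convert h using 1
  rw [context, Finset.map_val, Multiset.map_map]
  refine Multiset.map_congr rfl fun i _ => ?_
  exact congrArg (· • _) ((proj_injective e).extend_apply c 0 i)

end HilbertEffect

namespace ConvexEffectAlgebra

open EffectAlgebra HilbertEffect

section Contexts

variable {E : Type u} [ConvexEffectAlgebra E]

theorem Context.nonempty (A : Context E) : Nonempty A.carrier := by
  rw [Finset.nonempty_coe_sort, Finset.nonempty_iff_ne_empty]
  intro h
  have hsum := A.sum_eq_one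
  rw [h] at hsum
  exact EffectAlgebra.zero_ne_one (isOrthoSum_zero_iff.1 hsum).symm

/-- The state `â`, for `a` in the context `A`. -/
noncomputable abbrev Context.hat (κ : HatChoice E) (A : Context E) (a : A.carrier) : State E :=
  κ.hat a (A.isOneDimSharp a a.2)

theorem Context.exists_isOrthoSum_smul (A : Context E) (c : E → unitInterval) :
    ∃ b, IsOrthoSum (A.carrier.val.map fun a => c a • a) b := by
  obtain ⟨b, hb, -⟩ := IsOrthoSum.mono (f := id) (g := fun a => c a • a)
    ((Multiset.map_id A.carrier.val).symm ▸ A.sum_eq_one) fun a _ => smul_le (c a) a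
  exact ⟨b, hb⟩

theorem Context.state_eq_sum (ω : State E) {A : Context E} {c : E → unitInterval} {b : E}
    (h : IsOrthoSum (A.carrier.val.map fun a => c a • a) b) :
    (ω.1 b : ℝ) = ∑ a : A.carrier, (c a : ℝ) * ω.1 a := by
  rw [State.sum h, Multiset.map_map, Finset.sum_coe_sort A.carrier fun a => (c a : ℝ) * ω.1 a]
  exact Finset.sum_congr rfl fun a _ => state_smul ω (c a) a

theorem Context.exists_eq_half_smul {A : Context E} {c : E → unitInterval} {b : E}
    (hb : IsOrthoSum (A.carrier.val.map fun a => c a • a) b)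
    (hc : ∀ a ∈ A.carrier, (c a : ℝ) ≤ 1 / 2) : ∃ d, b = half • d := by
  have double : ∀ a ∈ A.carrier, ∃ t : unitInterval, c a = half * t := fun a ha =>
    ⟨⟨2 * c a, by linarith [(c a).2.1], by linarith [hc a ha]⟩,
      Subtype.ext (by rw [Set.Icc.coe_mul, coe_half]; ring)⟩
  choose! c' hc' using double
  obtain ⟨d, hd⟩ := A.exists_isOrthoSum_smul c'
  refine ⟨d, hb.unique ?_⟩
  have h := isOrthoSum_smul hd half
  rw [Multiset.map_map] at h
  convert h using 1
  exact Multiset.map_congr rfl fun a ha => by rw [Function.comp_apply, smul_smul', hc' a ha]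

end Contexts

section Frames

variable {E : Type u} [ConvexEffectAlgebra E] {H : Type v} [NormedAddCommGroup H]
  [InnerProductSpace ℂ H]

/-- Orthonormal bases of a single Hilbert space, one for each context, that represent the
transition probabilities between contexts and exhaust the rays of the space. A complete set of
contexts is the same as a frame, up to the choice of an identification of the spaces `H(A)` with a
common space. -/
structure IsFrame (κ : HatChoice E) (ψ : ∀ A : Context E, OrthonormalBasis A.carrier ℂ H) :
    Prop where
  transition : ∀ (A C : Context E) (a : A.carrier) (c : C.carrier),
    ‖⟪ψ A a, ψ C c⟫_ℂ‖ ^ 2 = ((A.hat κ a).1 c : ℝ)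
  exhaust : ∀ x : H, ‖x‖ = 1 → ∃ (A : Context E) (a : A.carrier) (z : ℂ),
    ‖z‖ = 1 ∧ ψ A a = z • x

variable {κ : HatChoice E} {ψ : ∀ A : Context E, OrthonormalBasis A.carrier ℂ H}

theorem Context.vec_eq_basisFun (A : Context E) (a : A.carrier) :
    A.vec a = EuclideanSpace.basisFun A.carrier ℂ a := by
  classical
  rw [Context.vec, EuclideanSpace.basisFun_apply]

theorem IsComplete.exists_isFrame (hκ : IsComplete κ) {B : Context E}
    (W : B.stateSpace ≃ₗᵢ[ℂ] H) :
    ∃ ψ : ∀ A : Context E, OrthonormalBasis A.carrier ℂ H, IsFrame κ ψ := by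
  obtain ⟨U, hU, exhaust⟩ := hκ
  refine ⟨fun A => (EuclideanSpace.basisFun A.carrier ℂ).map ((U A B).trans W), ?_, fun x hx => ?_⟩
  · intro A C a c
    rw [← hU.transition A B C a c, Context.vec_eq_basisFun, Context.vec_eq_basisFun]
    exact congrArg (‖·‖ ^ 2) (W.inner_map_map _ _)
  · obtain ⟨A, a, z, hz, h⟩ := exhaust B (W.symm x) ((W.symm.norm_map x).trans hx)
    refine ⟨A, a, z, hz, ?_⟩
    rw [Context.vec_eq_basisFun] at h
    exact (congrArg W h).trans (by rw [map_smul, W.apply_symm_apply])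

theorem IsFrame.isComplete (hψ : IsFrame κ ψ) : IsComplete κ := by
  have repr_apply_vec (A B : Context E) (a : A.carrier) :
      ((ψ A).repr.symm.trans (ψ B).repr) (A.vec a) = (ψ B).repr (ψ A a) := by
    classical
    rw [LinearIsometryEquiv.trans_apply, Context.vec, (ψ A).repr_symm_single]
  refine ⟨fun A B => (ψ A).repr.symm.trans (ψ B).repr,
    ⟨fun A => (ψ A).repr.symm_trans_self, fun A B => rfl, fun A B C a c => ?_⟩, fun B x hx => ?_⟩
  · rw [repr_apply_vec, repr_apply_vec, LinearIsometryEquiv.inner_map_map, hψ.transition]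
  · obtain ⟨A, a, z, hz, h⟩ := hψ.exhaust ((ψ B).repr.symm x)
      ((LinearIsometryEquiv.norm_map _ _).trans hx)
    exact ⟨A, a, z, hz, by rw [repr_apply_vec, h, map_smul, LinearIsometryEquiv.apply_symm_apply]⟩

theorem IsFrame.hat_eq_coeff (hψ : IsFrame κ ψ) {A : Context E} {c : E → unitInterval} {b : E}
    (h : IsOrthoSum (A.carrier.val.map fun a => c a • a) b) (a : A.carrier) :
    (A.hat κ a).1 b = c a := by
  classical
  refine Subtype.ext ?_
  have transition_self (d : A.carrier) : ((A.hat κ a).1 d : ℝ) = if a = d then 1 else 0 := by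
    rw [← hψ.transition A A a d, (ψ A).inner_eq_ite]
    split_ifs <;> simp
  simp [Context.state_eq_sum _ h, transition_self]

variable [Nontrivial H]

theorem IsFrame.exists_vectorState_eq (hψ : IsFrame κ ψ) {x : H} (hx : ‖x‖ = 1) :
    ∃ (C : Context E) (d : C.carrier),
      vectorState x hx = vectorState (ψ C d) ((ψ C).norm_eq_one d) := by
  obtain ⟨C, d, z, hz, h⟩ := hψ.exhaust x hx
  refine ⟨C, d, ?_⟩
  simp only [h]
  exact (vectorState_smul hz _).symm

variable [CompleteSpace H]

theorem IsFrame.vectorState_proj (hψ : IsFrame κ ψ) (A C : Context E) (a : A.carrier)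
    (d : C.carrier) :
    (vectorState (ψ C d) ((ψ C).norm_eq_one d)).1 (proj (ψ A a) ((ψ A).norm_eq_one a)) =
      (C.hat κ d).1 a :=
  Subtype.ext (by rw [HilbertEffect.vectorState_proj, norm_inner_symm, hψ.transition])

theorem IsFrame.hilbertEffect_ext (hψ : IsFrame κ ψ) {S T : HilbertEffect H}
    (h : ∀ (C : Context E) (d : C.carrier),
      (vectorState (ψ C d) ((ψ C).norm_eq_one d)).1 S =
        (vectorState (ψ C d) ((ψ C).norm_eq_one d)).1 T) : S = T := by
  refine ext_of_vectorState fun x hx => ?_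
  obtain ⟨C, d, hCd⟩ := hψ.exists_vectorState_eq hx
  rw [hCd, h]

theorem IsFrame.exists_hilbertEffect (hψ : IsFrame κ ψ) (hS : IsSpectral E) (b : E) :
    ∃ T : HilbertEffect H, ∀ (C : Context E) (d : C.carrier),
      (vectorState (ψ C d) ((ψ C).norm_eq_one d)).1 T = (C.hat κ d).1 b := by
  obtain ⟨A, c, hb⟩ := hS b
  obtain ⟨T, hT, -⟩ := (isOrthoSum_proj (ψ A)).mono fun a _ => smul_le (c a) _
  refine ⟨T, fun C d => Subtype.ext ?_⟩
  rw [State.sum hT, Multiset.map_map, Context.state_eq_sum _ hb]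
  exact Finset.sum_congr rfl fun a _ => by
    rw [Function.comp_apply, state_smul, hψ.vectorState_proj]

/-- The effect of `E(H)` attached to an effect `b` of `E`: its probability in the state of each
frame vector is the probability of `b` in the corresponding state of `E`. -/
noncomputable def IsFrame.toHilbertEffect (hψ : IsFrame κ ψ) (hS : IsSpectral E) (b : E) :
    HilbertEffect H := (hψ.exists_hilbertEffect hS b).choose

theorem IsFrame.vectorState_toHilbertEffect (hψ : IsFrame κ ψ) (hS : IsSpectral E) (b : E)
    (C : Context E) (d : C.carrier) :
    (vectorState (ψ C d) ((ψ C).norm_eq_one d)).1 (hψ.toHilbertEffect hS b) = (C.hat κ d).1 b :=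
  (hψ.exists_hilbertEffect hS b).choose_spec C d

theorem IsFrame.isMorphism_toHilbertEffect (hψ : IsFrame κ ψ) (hS : IsSpectral E) :
    IsMorphism (hψ.toHilbertEffect hS) := by
  refine isMorphism_of_map_isSum (fun a b c h => ?_) (hψ.hilbertEffect_ext fun C d => ?_)
  · refine isSum_iff_forall_vectorState.2 fun x hx => ?_
    obtain ⟨C, d, hCd⟩ := hψ.exists_vectorState_eq hx
    simp only [hCd, vectorState_toHilbertEffect, State.add h]
  · rw [vectorState_toHilbertEffect, (C.hat κ d).2.map_one,
      (vectorState _ ((ψ C).norm_eq_one d)).2.map_one]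

theorem IsFrame.toHilbertEffect_smul (hψ : IsFrame κ ψ) (hS : IsSpectral E) (c : unitInterval)
    (b : E) : hψ.toHilbertEffect hS (c • b) = c • hψ.toHilbertEffect hS b :=
  hψ.hilbertEffect_ext fun C d => Subtype.ext (by
    simp only [state_smul, vectorState_toHilbertEffect])

theorem IsFrame.toHilbertEffect_coe (hψ : IsFrame κ ψ) (hS : IsSpectral E) {A : Context E}
    (a : A.carrier) : hψ.toHilbertEffect hS a = proj (ψ A a) ((ψ A).norm_eq_one a) :=
  hψ.hilbertEffect_ext fun C d => by
    rw [vectorState_toHilbertEffect, hψ.vectorState_proj]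

theorem IsFrame.orth_of_orth_toHilbertEffect (hψ : IsFrame κ ψ) (hS : IsSpectral E) {b d : E}
    (h : Orth (hψ.toHilbertEffect hS b) (hψ.toHilbertEffect hS d)) : Orth b d := by
  -- `b / 2 ⊕ d / 2` always exists, and `b ⊥ d` as soon as it is of the form `f / 2`.
  obtain ⟨e, he⟩ := exists_isSum_convex half b d
  rw [symm_half] at he
  obtain ⟨A, c, hc⟩ := hS e
  have coeff_le : ∀ a ∈ A.carrier, (c a : ℝ) ≤ 1 / 2 := by
    intro a ha
    have hcoeff := hψ.hat_eq_coeff hc ⟨a, ha⟩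
    let ω := vectorState (ψ A ⟨a, ha⟩) ((ψ A).norm_eq_one _)
    have hadd := State.add (ω := ω) ⟨h, rfl⟩
    rw [vectorState_toHilbertEffect, vectorState_toHilbertEffect] at hadd
    rw [← hcoeff, State.add he, state_smul, state_smul, coe_half, ← mul_add, ← hadd]
    linarith [unitInterval.le_one (ω.1 (osum _ _ h))]
  obtain ⟨f, rfl⟩ := Context.exists_eq_half_smul hc coeff_le
  exact (isSum_of_half he).1

theorem IsFrame.exists_toHilbertEffect_eq_proj (hψ : IsFrame κ ψ) (hS : IsSpectral E) {x : H}
    (hx : ‖x‖ = 1) : ∃ a, hψ.toHilbertEffect hS a = proj x hx := by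
  obtain ⟨A, a, z, hz, h⟩ := hψ.exhaust x hx
  refine ⟨a, (hψ.toHilbertEffect_coe hS a).trans ?_⟩
  simp only [h]
  exact proj_smul hz _

theorem IsFrame.isAffineIso_toHilbertEffect (hψ : IsFrame κ ψ) (hS : IsSpectral E) :
    IsAffineIso (hψ.toHilbertEffect hS) where
  toIsMorphism := hψ.isMorphism_toHilbertEffect hS
  orth_of_map _ _ := hψ.orth_of_orth_toHilbertEffect hS
  map_smul := hψ.toHilbertEffect_smul hS
  surjective T := by
    obtain ⟨A, -⟩ := hS 0
    have : FiniteDimensional ℂ H := (ψ A).toBasis.finiteDimensional_of_finite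
    obtain ⟨e, c, hT⟩ := exists_isOrthoSum_smul_proj T
    choose a ha using fun i => hψ.exists_toHilbertEffect_eq_proj hS (e.norm_eq_one i)
    have hT' : IsOrthoSum
        ((Finset.univ.val.map fun i => c i • a i).map (hψ.toHilbertEffect hS)) T := by
      simpa [Multiset.map_map, Function.comp_def, hψ.toHilbertEffect_smul, ha] using hT
    obtain ⟨s, -, hs⟩ := (hψ.isMorphism_toHilbertEffect hS).exists_isOrthoSum_of_map
      (fun _ _ => hψ.orth_of_orth_toHilbertEffect hS) hT'
    exact ⟨s, hs⟩

end Frames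

theorem isHilbertian_of_isComplete {E : Type u} [ConvexEffectAlgebra E] {κ : HatChoice E}
    (hκ : IsComplete κ) (hS : IsSpectral E) : IsHilbertian.{u, v} E := by
  obtain ⟨B, -⟩ := hS 0
  have := B.nonempty
  let index : B.carrier ≃ ULift.{v} (Fin (Fintype.card B.carrier)) :=
    (Fintype.equivFin B.carrier).trans Equiv.ulift.symm
  have := index.symm.nonempty
  obtain ⟨ψ, hψ⟩ := hκ.exists_isFrame (LinearIsometryEquiv.piLpCongrLeft 2 ℂ ℂ index)
  exact ⟨_, _, _, inferInstance, inferInstance, _, hψ.isAffineIso_toHilbertEffect hS⟩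

end ConvexEffectAlgebra

namespace ConvexEffectAlgebra

open EffectAlgebra HilbertEffect

section AffineIsoHilbertEffect

variable {E : Type u} [ConvexEffectAlgebra E] {H : Type v} [NormedAddCommGroup H]
  [InnerProductSpace ℂ H] [CompleteSpace H] [Nontrivial H] {φ : E → HilbertEffect H}

theorem IsAffineIso.exists_orthonormalBasis (hφ : IsAffineIso φ) (A : Context E) :
    ∃ e : OrthonormalBasis A.carrier ℂ H,
      ∀ a : A.carrier, φ a = proj (e a) (e.norm_eq_one a) := by
  choose x hx hφx using fun a : A.carrier =>
    exists_eq_proj_of_isOneDimSharp ((A.isOneDimSharp a a.2).map hφ)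
  have hsum (y : H) (hy : ‖y‖ = 1) : ∑ a, ‖⟪x a, y⟫_ℂ‖ ^ 2 = 1 := by
    have h := State.sum (ω := vectorState y hy) (hφ.toIsMorphism.map_isOrthoSum A.sum_eq_one)
    rw [hφ.map_one, (vectorState y hy).2.map_one, Multiset.map_map] at h
    refine Eq.trans ?_ h.symm
    rw [Finset.sum_map_val, ← Finset.sum_coe_sort A.carrier]
    exact Finset.sum_congr rfl fun a _ => by
      rw [Function.comp_apply, hφx, HilbertEffect.vectorState_proj]
  obtain ⟨e, he⟩ := exists_orthonormalBasis_of_sum_sq_norm_inner hx hsum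
  exact ⟨e, fun a => by simp only [he, hφx]⟩

theorem IsAffineIso.hat_eq_vectorState (hφ : IsAffineIso φ) (κ : HatChoice E) {a : E}
    (ha : IsOneDimSharp a) {x : H} {hx : ‖x‖ = 1} (h : φ a = proj x hx) (b : E) :
    (κ.hat a ha).1 b = (vectorState x hx).1 (φ b) := by
  obtain ⟨χ, hχ, hl, -⟩ := hφ.exists_inverse
  have hω : ((κ.hat a ha).comp hχ.toIsMorphism).1 (proj x hx) = 1 :=
    (congrArg (κ.hat a ha).1 (by rw [← h, hl])).trans (κ.hat_self a ha)
  rw [← state_eq_vectorState hω]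
  exact congrArg (κ.hat a ha).1 (hl b).symm

theorem IsAffineIso.nonempty_hatChoice (hφ : IsAffineIso φ) : Nonempty (HatChoice E) := by
  choose x hx hφx using fun (a : E) (ha : IsOneDimSharp a) =>
    exists_eq_proj_of_isOneDimSharp (ha.map hφ)
  exact ⟨fun a ha => (vectorState (x a ha) (hx a ha)).comp hφ.toIsMorphism, fun a ha =>
    (congrArg _ (hφx a ha)).trans vectorState_proj_self⟩

theorem IsAffineIso.exists_context_mem [FiniteDimensional ℂ H] (hφ : IsAffineIso φ) {x : H}
    (hx : ‖x‖ = 1) : ∃ (A : Context E) (a : A.carrier), φ a = proj x hx := by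
  obtain ⟨χ, hχ, -, hr⟩ := hφ.exists_inverse
  have hx' : Orthonormal ℂ ((↑) : ({x} : Set H) → H) :=
    ⟨by simp [hx], fun i j hij => (hij (Subsingleton.elim i j)).elim⟩
  obtain ⟨u, e, hxu, he⟩ := hx'.exists_orthonormalBasis_extension
  let i : u := ⟨x, hxu rfl⟩
  refine ⟨(HilbertEffect.context e).map hχ, ⟨χ (proj (e i) (e.norm_eq_one i)), ?_⟩, ?_⟩
  · exact Finset.mem_map_of_mem _ (Finset.mem_map_of_mem _ (Finset.mem_univ i))
  · simp only [hr _, he, i]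

theorem IsAffineIso.exists_isFrame [FiniteDimensional ℂ H] (hφ : IsAffineIso φ)
    (κ : HatChoice E) :
    ∃ ψ : ∀ A : Context E, OrthonormalBasis A.carrier ℂ H, IsFrame κ ψ := by
  choose ψ hψ using hφ.exists_orthonormalBasis
  refine ⟨ψ, fun A C a c => ?_, fun x hx => ?_⟩
  · rw [Context.hat, hφ.hat_eq_vectorState κ _ (hψ A a), hψ C c, HilbertEffect.vectorState_proj,
      norm_inner_symm]
  · obtain ⟨A, a, h⟩ := hφ.exists_context_mem hx
    exact ⟨A, a, exists_eq_smul_of_proj_eq ((hψ A a).symm.trans h)⟩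

end AffineIsoHilbertEffect

theorem isComplete_of_isHilbertian {E : Type u} [ConvexEffectAlgebra E]
    (hE : IsFiniteDimensional E) (h : IsHilbertian.{u, v} E) :
    Nonempty (HatChoice E) ∧ (∀ κ : HatChoice E, IsComplete κ) ∧ IsSpectral E := by
  obtain ⟨A⟩ := hE
  obtain ⟨H, _, _, _, _, φ, hφ⟩ := h
  obtain ⟨e, -⟩ := hφ.exists_orthonormalBasis A
  have : FiniteDimensional ℂ H := e.toBasis.finiteDimensional_of_finite
  obtain ⟨χ, hχ, -⟩ := hφ.exists_inverse
  refine ⟨hφ.nonempty_hatChoice, fun κ => ?_, HilbertEffect.isSpectral.map hχ⟩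
  obtain ⟨ψ, hψ⟩ := hφ.exists_isFrame κ
  exact hψ.isComplete

end ConvexEffectAlgebra

theorem theorem3p3 {E : Type u} [ConvexEffectAlgebra E]
    (hE : ConvexEffectAlgebra.IsFiniteDimensional E) :
    (IsHilbertian.{u, v} E ↔
      (∃ κ : ConvexEffectAlgebra.HatChoice E, ConvexEffectAlgebra.IsComplete κ) ∧
        ConvexEffectAlgebra.IsSpectral E) ∧
    ∀ κ : ConvexEffectAlgebra.HatChoice E,
      (IsHilbertian.{u, v} E ↔
        ConvexEffectAlgebra.IsComplete κ ∧ ConvexEffectAlgebra.IsSpectral E) := by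
  refine ⟨⟨fun h => ?_, ?_⟩, fun κ => ⟨fun h => ?_, ?_⟩⟩
  · obtain ⟨⟨κ⟩, hκ, hS⟩ := ConvexEffectAlgebra.isComplete_of_isHilbertian hE h
    exact ⟨⟨κ, hκ κ⟩, hS⟩
  · rintro ⟨⟨κ, hκ⟩, hS⟩
    exact ConvexEffectAlgebra.isHilbertian_of_isComplete hκ hS
  · obtain ⟨-, hκ, hS⟩ := ConvexEffectAlgebra.isComplete_of_isHilbertian hE h
    exact ⟨hκ κ, hS⟩
  · rintro ⟨hκ, hS⟩
    exact ConvexEffectAlgebra.isHilbertian_of_isComplete hκ hS
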